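/- Let $S^*\in\mathbb{R}^{p\times p}$ be symmetric positive definite with smallest and largest eigenvalues $S_p$ and $S_1$, let $L^*\in\mathbb{R}^{p\times p}$ be symmetric positive semidefinite (psd) of rank at most $r$, and put $\Theta^*=S^*+L^*$. Let $X_1,\dots,X_n$ be i.i.d. $\mathcal{N}(0,(\Theta^*)^{-1})$ vectors in $\mathbb{R}^p$, let $C=\frac1n\sum_{i=1}^n X_iX_i^T$, and let $$F(L)=-\log\det(S^*+L)+\langle S^*+L,\,C\rangle .$$ The algorithm EP-LVM with step size $\eta$ produces $L^0=0$ and $L^{t+1}=\mathcal{P}_r^+\bigl(L^t-\eta\nabla F(L^t)\bigr)$, where $\mathcal{P}_r^+(A)$ is a Frobenius-nearest psd matrix of rank at most $r$ to $A$. For $\delta>0$ put $$m_{3r}=\frac{1}{\bigl(S_1+(1+\sqrt r)\|L^*\|_2+\delta\bigr)^2},\qquad M_{3r}=\frac1{S_p^2},\qquad \rho=2\sqrt{1+M_{3r}^2\eta^2-2m_{3r}\eta}.$$ There is an absolute constant $c>0$ such that the following holds for all such $p,n,r,S^*,L^*$, all $\delta>0$ and all $\eta$. Assume that $$S_p\le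 S_1\le\sqrt{\tfrac{2}{\sqrt3}}\,S_p-(1+\sqrt r)\|L^*\|_2-\delta,\qquad \rho<1,\qquad n\ \ge\ c\,\|(\Theta^*)^{-1}\|_2^2\;\frac1{\delta^2}\Bigl(\frac{\eta}{1-\rho}\Bigr)^2 rp .$$ Then $m_{3r}>0$, $1\le M_{3r}/m_{3r}\le 2/\sqrt3$ and $0.5/M_{3r}\le\eta\le 1.5/m_{3r}$, and, with probability at least $1-2e^{-p}$, $F$ satisfies the RSC/RSS conditions with these constants in each iteration, in the following sense. Let $\mathcal{K}$ be the set of psd matrices $L$ with $\|L\|_2\le(1+\sqrt r)\|L^*\|_2+\delta$. Then $L^*\in\mathcal{K}$, every iterate $L^t$ ($t\ge0$) of EP-LVM lies in $\mathcal{K}$, and for all $L_1,L_2\in\mathcal{K}$ of rank at most $3r$, $$\frac{m_{3r}}2\|L_2-L_1\|_F^2\le F(L_2)-F(L_1)-\langle\nabla F(L_1),L_2-L_1\rangle\le\frac{M_{3r}}2\|L_2-L_1\|_F^2 .$$ -/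

import Mathlib

open MeasureTheory ProbabilityTheory

noncomputable section

namespace LVM

/-- Frobenius inner product `⟨A, B⟩ = tr (Aᵀ B)`. -/
def frobInner {p : ℕ} (A B : Matrix (Fin p) (Fin p) ℝ) : ℝ := (A.transpose * B).trace

/-- Frobenius norm. -/
def frobNorm {p : ℕ} (A : Matrix (Fin p) (Fin p) ℝ) : ℝ := Real.sqrt (frobInner A A)

/-- Spectral norm: the operator norm for the Euclidean norm on `ℝ^p`. -/
def specNorm {p : ℕ} (A : Matrix (Fin p) (Fin p) ℝ) : ℝ :=
  ‖Matrix.toEuclideanCLM (n := Fin p) (𝕜 := ℝ) A‖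

/-- Maximum (real) eigenvalue. -/
def eigMax {p : ℕ} (A : Matrix (Fin p) (Fin p) ℝ) : ℝ := sSup (spectrum ℝ A)

/-- Minimum (real) eigenvalue. -/
def eigMin {p : ℕ} (A : Matrix (Fin p) (Fin p) ℝ) : ℝ := sInf (spectrum ℝ A)

/-- Sample covariance matrix `C = (1/n) ∑ xᵢ xᵢᵀ`. -/
def sampleCov {p n : ℕ} (x : Fin n → EuclideanSpace ℝ (Fin p)) : Matrix (Fin p) (Fin p) ℝ :=
  Matrix.of fun a b => (1 / (n : ℝ)) * ∑ i, x i a * x i b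

/-- Negative log-likelihood `F(L) = - log det (S + L) + ⟨S + L, C⟩`. -/
def loss {p : ℕ} (S C L : Matrix (Fin p) (Fin p) ℝ) : ℝ :=
  - Real.log (S + L).det + frobInner (S + L) C

/-- Gradient of a function of a matrix for the Frobenius inner product: the matrix of the
partial derivatives with respect to the entries. -/
def matGrad {p : ℕ} (f : Matrix (Fin p) (Fin p) ℝ → ℝ) (L : Matrix (Fin p) (Fin p) ℝ) :
    Matrix (Fin p) (Fin p) ℝ :=
  Matrix.of fun i j => deriv (fun s : ℝ => f (L + s • Matrix.single i j (1 : ℝ))) 0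

/-- Restricted strong convexity and restricted strong smoothness of `f`, with constants `m`
and `M`, for matrices of rank at most `k` in the region `K`. -/
def RSCRSSOn {p : ℕ} (f : Matrix (Fin p) (Fin p) ℝ → ℝ) (k : ℕ) (m M : ℝ)
    (K : Set (Matrix (Fin p) (Fin p) ℝ)) : Prop :=
  ∀ L₁ ∈ K, ∀ L₂ ∈ K, L₁.rank ≤ k → L₂.rank ≤ k →
    m / 2 * frobNorm (L₂ - L₁) ^ 2 ≤ f L₂ - f L₁ - frobInner (matGrad f L₁) (L₂ - L₁) ∧
    f L₂ - f L₁ - frobInner (matGrad f L₁) (L₂ - L₁) ≤ M / 2 * frobNorm (L₂ - L₁) ^ 2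

/-- `B` is a projection `𝒫_r⁺(A)` of `A` onto the psd matrices of rank at most `r`: a nearest
such matrix in Frobenius norm (not unique when eigenvalues of `A` tie). -/
def IsPsdLowRankProj {p : ℕ} (r : ℕ) (A B : Matrix (Fin p) (Fin p) ℝ) : Prop :=
  B.PosSemidef ∧ B.rank ≤ r ∧
    ∀ Z : Matrix (Fin p) (Fin p) ℝ, Z.PosSemidef → Z.rank ≤ r →
      frobNorm (A - B) ≤ frobNorm (A - Z)

/-- `L` is a sequence of iterates of EP-LVM with inputs `S`, `C`, rank `r`, step size `η`. -/
def IsEPLVM {p : ℕ} (S C : Matrix (Fin p) (Fin p) ℝ) (r : ℕ) (η : ℝ)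
    (L : ℕ → Matrix (Fin p) (Fin p) ℝ) : Prop :=
  L 0 = 0 ∧ ∀ t, IsPsdLowRankProj r (L t - η • matGrad (loss S C) (L t)) (L (t + 1))

/-- The psd matrices of spectral norm at most `(1 + √r) ‖Lstar‖₂ + δ`. -/
def region {p : ℕ} (r : ℕ) (Lstar : Matrix (Fin p) (Fin p) ℝ) (δ : ℝ) :
    Set (Matrix (Fin p) (Fin p) ℝ) :=
  {L | L.PosSemidef ∧ specNorm L ≤ (1 + Real.sqrt r) * specNorm Lstar + δ}

/-- The RSC constant `1 / (S₁ + (1 + √r) ‖Lstar‖₂ + δ)²`. -/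
def mConst {p : ℕ} (r : ℕ) (S Lstar : Matrix (Fin p) (Fin p) ℝ) (δ : ℝ) : ℝ :=
  1 / (eigMax S + (1 + Real.sqrt r) * specNorm Lstar + δ) ^ 2

/-- The RSS constant `1 / S_p²`. -/
def MConst {p : ℕ} (S : Matrix (Fin p) (Fin p) ℝ) : ℝ := 1 / eigMin S ^ 2

/-- The contraction factor `ρ = 2 √(1 + M² η² - 2 m η)`. -/
def rho (m M η : ℝ) : ℝ := 2 * Real.sqrt (1 + M ^ 2 * η ^ 2 - 2 * m * η)

end LVM

end

/-!
The region consists of matrices `L` for which the spectrum of `S + L` lies in `[a, b]`, where `a` is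
the smallest eigenvalue of `S` and `b = S₁ + (1 + √r) ‖Lstar‖₂ + δ`. On such matrices the second
derivative `D ↦ tr (Θ⁻¹ D Θ⁻¹ D)` of `-log det` lies between `m ‖D‖²` and `M ‖D‖²`, with `m = 1/b²`
and `M = 1/a²`. The linear term of the loss does not matter, so the RSC/RSS inequalities hold for
every sample and for all ranks (`loss_remainder_bounds`).

The iterates are the probabilistic part. The exact gradient step `Δ ↦ Δ - η (Θ*⁻¹ - Θ⁻¹)`, with
`Θ = Θ* + Δ`, contracts by `√(1 + M²η² - 2mη) = ρ/2`, and passing to a nearest psd matrix of rank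
at most `r` costs a factor `2`. The true gradient at `Lstar` is the sampling error
`C - (Θ*)⁻¹`; paired with a matrix of rank at most `2r` it costs `√(2r)` times its spectral norm.
So (`frobNorm_step_le`)
`‖L^{t+1} - Lstar‖_F ≤ ρ ‖L^t - Lstar‖_F + 2 η √(2r) ‖C - (Θ*)⁻¹‖₂`.
If the last term is at most `(1 - ρ) δ`, then `‖L^t - Lstar‖_F ≤ √r ‖Lstar‖₂ + δ` for all `t`, by
induction, and this bound puts `L^t` in the region (`iterates_mem_region`).

The sampling error is at most `8 ‖(Θ*)⁻¹‖₂ √(40 p / n)` with probability at least `1 - 2 e^{-p}`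
(`exists_event_specNorm_sampleCov_sub_le`): for a fixed vector the quadratic form of the error is an
average of centred Gaussian squares, to which Chernoff's bound applies, and a union bound over the
at most `50^p` points of `exists_finset_specNorm_le` controls the spectral norm. The assumed sample size
makes this small enough when `r ≥ 1`, and for `r = 0` all iterates vanish.
-/

namespace LVM

open Matrix
open scoped MatrixOrder NNReal

section

/-! ### Frobenius geometry -/

/-- The entries of a matrix as a vector of Euclidean space, so that the Frobenius inner product
and norm become the Euclidean ones. -/
def entries {p : ℕ} : Matrix (Fin p) (Fin p) ℝ →ₗ[ℝ] EuclideanSpace ℝ (Fin p × Fin p) where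
  toFun A := WithLp.toLp 2 fun ij => A ij.1 ij.2
  map_add' _ _ := rfl
  map_smul' _ _ := rfl

variable {p : ℕ} {A B D : Matrix (Fin p) (Fin p) ℝ} {a b : ℝ}

lemma inner_entries (A B : Matrix (Fin p) (Fin p) ℝ) :
    inner ℝ (entries A) (entries B) = frobInner A B := by
  have h : ∀ (C : Matrix (Fin p) (Fin p) ℝ) i j, entries C (i, j) = C i j := fun _ _ _ => rfl
  simp only [frobInner, PiLp.inner_apply, Matrix.trace, Matrix.diag, Matrix.mul_apply,
    Fintype.sum_prod_type, Matrix.transpose_apply, h]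
  rw [Finset.sum_comm]
  simp [mul_comm]

lemma norm_entries (A : Matrix (Fin p) (Fin p) ℝ) : ‖entries A‖ = frobNorm A := by
  rw [frobNorm, ← inner_entries, real_inner_self_eq_norm_sq, Real.sqrt_sq (norm_nonneg _)]

lemma frobNorm_sq (A : Matrix (Fin p) (Fin p) ℝ) : frobNorm A ^ 2 = frobInner A A := by
  rw [← norm_entries, ← inner_entries, real_inner_self_eq_norm_sq]

lemma frobNorm_nonneg (A : Matrix (Fin p) (Fin p) ℝ) : 0 ≤ frobNorm A := Real.sqrt_nonneg _

lemma frobInner_le (A B : Matrix (Fin p) (Fin p) ℝ) :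
    frobInner A B ≤ frobNorm A * frobNorm B := by
  rw [← norm_entries, ← norm_entries, ← inner_entries]
  exact real_inner_le_norm _ _

lemma frobInner_eq_trace (hA : A.IsHermitian) : frobInner A B = (A * B).trace := by
  rw [frobInner, ← Matrix.conjTranspose_eq_transpose_of_trivial, hA.eq]

/-! ### Positive semidefinite matrices -/

lemma trace_mul_nonneg (hA : 0 ≤ A) (hB : 0 ≤ B) : 0 ≤ (A * B).trace := by
  obtain ⟨C, rfl⟩ := CStarAlgebra.nonneg_iff_eq_star_mul_self.mp hB
  rw [← Matrix.mul_assoc, Matrix.trace_mul_comm, ← Matrix.mul_assoc]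
  exact ((nonneg_iff_posSemidef.mp hA).mul_mul_conjTranspose_same C).trace_nonneg

lemma conj_nonneg (hA : 0 ≤ A) (hD : D.IsHermitian) : 0 ≤ D * A * D := by
  have h := (nonneg_iff_posSemidef.mp hA).mul_mul_conjTranspose_same D
  rw [hD.eq] at h
  exact h.nonneg

lemma smul_one_nonneg (ha : 0 ≤ a) : 0 ≤ a • (1 : Matrix (Fin p) (Fin p) ℝ) :=
  (PosSemidef.one.smul ha).nonneg

/-- With `trace_sandwich_le`: the quadratic form `D ↦ tr (D A D B)`, which is the second derivative
of `-log det` when `A = B` is the inverse matrix, lies between the products of the spectral bounds. -/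
lemma le_trace_sandwich (hD : D.IsHermitian) (ha : 0 ≤ a) (hb : 0 ≤ b) (hA : a • 1 ≤ A)
    (hB : b • 1 ≤ B) : a * b * frobNorm D ^ 2 ≤ (D * A * D * B).trace := by
  have h1 := trace_mul_nonneg (conj_nonneg (sub_nonneg.mpr hA) hD)
    ((smul_one_nonneg hb).trans hB)
  have h2 := trace_mul_nonneg (conj_nonneg (zero_le_one (α := Matrix (Fin p) (Fin p) ℝ)) hD)
    (sub_nonneg.mpr hB)
  rw [frobNorm_sq, frobInner_eq_trace hD]
  simp only [mul_sub, sub_mul, mul_one, mul_smul_comm, smul_mul_assoc, trace_sub, trace_smul,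
    smul_eq_mul, sub_nonneg] at h1 h2
  nlinarith

lemma trace_sandwich_le (hD : D.IsHermitian) (ha : 0 ≤ a) (hA : A ≤ a • 1) (hB0 : 0 ≤ B)
    (hB : B ≤ b • 1) : (D * A * D * B).trace ≤ a * b * frobNorm D ^ 2 := by
  have h1 := trace_mul_nonneg (conj_nonneg (sub_nonneg.mpr hA) hD) hB0
  have h2 := trace_mul_nonneg (conj_nonneg (zero_le_one (α := Matrix (Fin p) (Fin p) ℝ)) hD)
    (sub_nonneg.mpr hB)
  rw [frobNorm_sq, frobInner_eq_trace hD]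
  simp only [mul_sub, sub_mul, mul_one, mul_smul_comm, smul_mul_assoc, trace_sub, trace_smul,
    smul_eq_mul, sub_nonneg] at h1 h2
  nlinarith

/-- Squaring preserves the bounds `0 ≤ A ≤ a`; squaring is not monotone for the Loewner order in
general, but `A` commutes with `a • 1`. -/
lemma mul_self_le (ha : 0 ≤ a) (h0 : 0 ≤ A) (hA : A ≤ a • 1) : A * A ≤ (a * a) • 1 := by
  have h1 : 0 ≤ A * (a • 1 - A) := Commute.mul_nonneg h0 (sub_nonneg.mpr hA)
    (by simp [Commute, SemiconjBy, mul_sub, sub_mul])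
  have h2 : 0 ≤ a • (a • 1 - A) :=
    ((nonneg_iff_posSemidef.mp (sub_nonneg.mpr hA)).smul ha).nonneg
  have h := add_nonneg h1 h2
  rw [← sub_nonneg]
  convert h using 1
  simp only [mul_sub, mul_smul_comm, mul_one, smul_sub, smul_smul]
  abel

lemma posDef_of_le (ha : 0 < a) (hA : a • 1 ≤ A) : A.PosDef := by
  have := (PosDef.one.smul ha).add_posSemidef (nonneg_iff_posSemidef.mp (sub_nonneg.mpr hA))
  simpa using this

lemma inv_le_of_le (ha : 0 < a) (hA : a • 1 ≤ A) : A⁻¹ ≤ a⁻¹ • 1 := by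
  have hpd := posDef_of_le ha hA
  have hu : IsUnit A.det := (Matrix.isUnit_iff_isUnit_det _).mp hpd.isUnit
  have h1 : 0 ≤ A⁻¹ * (A - a • 1) := Commute.mul_nonneg hpd.inv.posSemidef.nonneg
    (sub_nonneg.mpr hA) (by
      simp [Commute, SemiconjBy, mul_sub, sub_mul, Matrix.mul_nonsing_inv _ hu,
        Matrix.nonsing_inv_mul _ hu])
  have h2 := ((nonneg_iff_posSemidef.mp h1).smul (inv_nonneg.mpr ha.le)).nonneg
  rw [← sub_nonneg]
  convert h2 using 1
  simp [mul_sub, Matrix.nonsing_inv_mul _ hu, smul_sub, smul_smul, ha.ne']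

lemma le_inv_of_le (hpd : A.PosDef) (hb : 0 < b) (hA : A ≤ b • 1) : b⁻¹ • 1 ≤ A⁻¹ := by
  have hu : IsUnit A.det := (Matrix.isUnit_iff_isUnit_det _).mp hpd.isUnit
  have h1 : 0 ≤ A⁻¹ * (b • 1 - A) := Commute.mul_nonneg hpd.inv.posSemidef.nonneg
    (sub_nonneg.mpr hA) (by
      simp [Commute, SemiconjBy, mul_sub, sub_mul, Matrix.mul_nonsing_inv _ hu,
        Matrix.nonsing_inv_mul _ hu])
  have h2 := ((nonneg_iff_posSemidef.mp h1).smul (inv_nonneg.mpr hb.le)).nonneg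
  rw [← sub_nonneg]
  convert h2 using 1
  simp [mul_sub, Matrix.nonsing_inv_mul _ hu, smul_sub, smul_smul, hb.ne']

/-! ### Spectral norm -/

lemma abs_dotProduct_mulVec_le (A : Matrix (Fin p) (Fin p) ℝ) (x y : EuclideanSpace ℝ (Fin p)) :
    |x ⬝ᵥ A *ᵥ y| ≤ specNorm A * (‖x‖ * ‖y‖) := by
  rw [← Matrix.inner_toEuclideanCLM]
  calc _ ≤ ‖x‖ * ‖toEuclideanCLM (n := Fin p) (𝕜 := ℝ) A y‖ := abs_real_inner_le_norm _ _
    _ ≤ ‖x‖ * (specNorm A * ‖y‖) := by gcongr; exact ContinuousLinearMap.le_opNorm _ _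
    _ = _ := by ring

lemma le_smul_one_of_specNorm_le (hA : A.IsHermitian) (h : specNorm A ≤ a) : A ≤ a • 1 := by
  rw [le_iff]
  refine PosSemidef.of_dotProduct_mulVec_nonneg
    ((isHermitian_one.smul (IsSelfAdjoint.all a)).sub hA) fun x => ?_
  have h1 := abs_dotProduct_mulVec_le A (WithLp.toLp 2 x) (WithLp.toLp 2 x)
  have h2 : ‖(WithLp.toLp 2 x : EuclideanSpace ℝ (Fin p))‖ ^ 2 = x ⬝ᵥ x := by
    rw [EuclideanSpace.real_norm_sq_eq]; simp [dotProduct, sq]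
  have h3 := (le_abs_self _).trans h1
  have h4 : specNorm A * (x ⬝ᵥ x) ≤ a * (x ⬝ᵥ x) := by
    gcongr; rw [← h2]; positivity
  rw [← sq, h2] at h3
  simp only [star_trivial, sub_mulVec, smul_mulVec, one_mulVec, dotProduct_sub, dotProduct_smul,
    smul_eq_mul]
  linarith [h3]

lemma specNorm_nonneg (A : Matrix (Fin p) (Fin p) ℝ) : 0 ≤ specNorm A := norm_nonneg _

lemma specNorm_le_add (A B : Matrix (Fin p) (Fin p) ℝ) :
    specNorm A ≤ specNorm B + specNorm (A - B) := by
  have h : A = B + (A - B) := by abel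
  unfold specNorm
  conv_lhs => rw [h, map_add]
  exact norm_add_le _ _

lemma specNorm_le_frobNorm (A : Matrix (Fin p) (Fin p) ℝ) : specNorm A ≤ frobNorm A := by
  refine ContinuousLinearMap.opNorm_le_bound _ (frobNorm_nonneg A) fun x => ?_
  refine abs_le_of_sq_le_sq' ?_ (by have := frobNorm_nonneg A; positivity) |>.2
  rw [mul_pow, ← norm_entries, EuclideanSpace.real_norm_sq_eq, EuclideanSpace.real_norm_sq_eq,
    EuclideanSpace.real_norm_sq_eq, Fintype.sum_prod_type, Finset.sum_mul]
  refine Finset.sum_le_sum fun i _ => ?_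
  exact Finset.sum_mul_sq_le_sq_mul_sq Finset.univ (A i) x

lemma frobInner_eq_sum_eigenvalues (hA : A.IsHermitian) (B : Matrix (Fin p) (Fin p) ℝ) :
    frobInner A B = ∑ i, hA.eigenvalues i *
      (hA.eigenvectorBasis i ⬝ᵥ B *ᵥ hA.eigenvectorBasis i) := by
  rw [frobInner_eq_trace hA, Matrix.trace_mul_comm]
  have h := LinearMap.trace_eq_sum_inner
    (toEuclideanCLM (n := Fin p) (𝕜 := ℝ) (B * A)).toLinearMap hA.eigenvectorBasis
  rw [coe_toEuclideanCLM_eq_toEuclideanLin, toEuclideanLin_eq_toLin_orthonormal,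
    Matrix.trace_toLin_eq] at h
  rw [h]
  refine Finset.sum_congr rfl fun i _ => ?_
  rw [← toEuclideanLin_eq_toLin_orthonormal, ← coe_toEuclideanCLM_eq_toEuclideanLin,
    ContinuousLinearMap.coe_coe, inner_toEuclideanCLM, ← mulVec_mulVec,
    hA.mulVec_eigenvectorBasis, mulVec_smul, dotProduct_smul, smul_eq_mul]

lemma dotProduct_eigenvectorBasis_self (hA : A.IsHermitian) (i : Fin p) :
    (hA.eigenvectorBasis i : Fin p → ℝ) ⬝ᵥ hA.eigenvectorBasis i = 1 := by
  have h := hA.eigenvectorBasis.orthonormal.1 i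
  have h2 := EuclideanSpace.real_norm_sq_eq (hA.eigenvectorBasis i)
  rw [h] at h2
  simp only [dotProduct, ← sq]
  linarith

lemma frobNorm_sq_eq_sum_eigenvalues (hA : A.IsHermitian) :
    frobNorm A ^ 2 = ∑ i, hA.eigenvalues i ^ 2 := by
  rw [frobNorm_sq, frobInner_eq_sum_eigenvalues hA]
  refine Finset.sum_congr rfl fun i _ => ?_
  rw [hA.mulVec_eigenvectorBasis, dotProduct_smul, dotProduct_eigenvectorBasis_self]
  simp [sq]

/-- The dual pairing of a low-rank matrix with the spectral norm; this is where the rank enters the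
estimates. -/
lemma abs_frobInner_le_of_rank_le (hA : A.IsHermitian) {k : ℕ} (hk : A.rank ≤ k)
    (B : Matrix (Fin p) (Fin p) ℝ) :
    |frobInner A B| ≤ Real.sqrt k * frobNorm A * specNorm B := by
  have hq (i) : |(hA.eigenvectorBasis i : Fin p → ℝ) ⬝ᵥ B *ᵥ hA.eigenvectorBasis i|
      ≤ specNorm B := by
    have h := abs_dotProduct_mulVec_le B (hA.eigenvectorBasis i) (hA.eigenvectorBasis i)
    rw [hA.eigenvectorBasis.orthonormal.1 i] at h
    simpa using h
  have h1 : |frobInner A B| ≤ (∑ i, |hA.eigenvalues i|) * specNorm B := by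
    rw [frobInner_eq_sum_eigenvalues hA, Finset.sum_mul]
    refine (Finset.abs_sum_le_sum_abs _ _).trans (Finset.sum_le_sum fun i _ => ?_)
    rw [abs_mul]
    exact mul_le_mul_of_nonneg_left (hq i) (abs_nonneg _)
  -- Cauchy–Schwarz, over the nonzero eigenvalues only
  have h2 : ∑ i, |hA.eigenvalues i| ≤ Real.sqrt k * frobNorm A := by
    refine abs_le_of_sq_le_sq' ?_ (mul_nonneg (Real.sqrt_nonneg _) (frobNorm_nonneg A)) |>.2
    rw [mul_pow, Real.sq_sqrt (Nat.cast_nonneg k), frobNorm_sq_eq_sum_eigenvalues hA]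
    set s := Finset.univ.filter fun i => hA.eigenvalues i ≠ 0
    have hs : (s.card : ℝ) ≤ k := by
      rw [hA.rank_eq_card_non_zero_eigs, Fintype.card_subtype] at hk
      exact_mod_cast hk
    have hs1 : ∑ i, |hA.eigenvalues i| = ∑ i ∈ s, |hA.eigenvalues i| := by
      rw [Finset.sum_filter_of_ne]
      intro i _ hi h0
      simp [h0] at hi
    rw [hs1]
    calc _ ≤ (s.card : ℝ) * ∑ i ∈ s, |hA.eigenvalues i| ^ 2 := sq_sum_le_card_mul_sum_sq
      _ ≤ k * ∑ i, hA.eigenvalues i ^ 2 := by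
        simp only [sq_abs]
        gcongr
        exact Finset.subset_univ s
  exact h1.trans (mul_le_mul_of_nonneg_right h2 (specNorm_nonneg B))

lemma frobNorm_le_sqrt_rank_mul_specNorm (hA : A.IsHermitian) {k : ℕ} (hk : A.rank ≤ k) :
    frobNorm A ≤ Real.sqrt k * specNorm A := by
  have h := abs_frobInner_le_of_rank_le hA hk A
  rw [← frobNorm_sq, abs_of_nonneg (sq_nonneg _)] at h
  rcases (frobNorm_nonneg A).eq_or_lt with h0 | h0
  · rw [← h0]; exact mul_nonneg (Real.sqrt_nonneg _) (specNorm_nonneg _)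
  · nlinarith

/-! ### Extreme eigenvalues -/

lemma eigMin_smul_one_le (hA : A.IsHermitian) : eigMin A • 1 ≤ A := by
  rw [← Algebra.algebraMap_eq_smul_one]
  exact algebraMap_le_of_le_spectrum
    (fun x hx => csInf_le Matrix.finite_real_spectrum.bddBelow hx) hA

lemma le_eigMax_smul_one (hA : A.IsHermitian) : A ≤ eigMax A • 1 := by
  rw [← Algebra.algebraMap_eq_smul_one]
  exact le_algebraMap_of_spectrum_le
    (fun x hx => le_csSup Matrix.finite_real_spectrum.bddAbove hx) hA

end

section

variable {p : ℕ} {A B D S C L : Matrix (Fin p) (Fin p) ℝ} {a b : ℝ}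

/-! ### The gradient of the loss and its first-order expansion -/

/-- Jacobi's formula along a line. -/
lemma hasDerivAt_det_add_smul (hA : IsUnit A.det) (D : Matrix (Fin p) (Fin p) ℝ) :
    HasDerivAt (fun s : ℝ => (A + s • D).det) (A.det * (A⁻¹ * D).trace) 0 := by
  have h : (fun s : ℝ => (A + s • D).det) = fun s : ℝ => A.det *
      (1 + (A⁻¹ * D).trace * s +
        ((1 + (Polynomial.X : Polynomial ℝ) • (A⁻¹ * D).map Polynomial.C).det.divX.divX).eval s *
          s ^ 2) := by
    funext s
    rw [← det_one_add_smul, ← det_mul, mul_add, mul_one, mul_smul_comm, ← Matrix.mul_assoc,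
      Matrix.mul_nonsing_inv _ hA, Matrix.one_mul]
  rw [h]
  have hq := ((1 + (Polynomial.X : Polynomial ℝ) • (A⁻¹ * D).map
    Polynomial.C).det.divX.divX).hasDerivAt (0 : ℝ)
  have := (((hasDerivAt_id' (0 : ℝ)).const_mul (A⁻¹ * D).trace).const_add 1).add
    (hq.mul (hasDerivAt_pow 2 (0 : ℝ)))
  refine (this.const_mul A.det).congr_deriv ?_
  simp

lemma hasDerivAt_log_det (hA : A.PosDef) (D : Matrix (Fin p) (Fin p) ℝ) :
    HasDerivAt (fun s : ℝ => Real.log (A + s • D).det) ((A⁻¹ * D).trace) 0 := by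
  have hu : IsUnit A.det := (Matrix.isUnit_iff_isUnit_det _).mp hA.isUnit
  have h := (hasDerivAt_det_add_smul hu D).log (by simpa using hu.ne_zero)
  refine h.congr_deriv ?_
  simp [hu.ne_zero]

lemma hasDerivAt_log_det_line (s₀ : ℝ) (D : Matrix (Fin p) (Fin p) ℝ)
    (hA : (A + s₀ • D).PosDef) :
    HasDerivAt (fun s : ℝ => Real.log (A + s • D).det) (((A + s₀ • D)⁻¹ * D).trace) s₀ := by
  have h := hasDerivAt_log_det hA D
  have h2 : HasDerivAt (fun s : ℝ => s - s₀) 1 s₀ := (hasDerivAt_id' s₀).sub_const s₀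
  rw [← sub_self s₀] at h
  have h3 := HasDerivAt.comp (h := fun s : ℝ => s - s₀) s₀ h h2
  rw [mul_one] at h3
  refine h3.congr_of_eventuallyEq (Filter.Eventually.of_forall fun s => ?_)
  simp only [Function.comp, add_assoc, ← add_smul, add_sub_cancel]

lemma matGrad_loss (h : (S + L).PosDef) (C : Matrix (Fin p) (Fin p) ℝ) :
    matGrad (loss S C) L = C - (S + L)⁻¹ := by
  ext i j
  have h1 := (hasDerivAt_log_det h (Matrix.single i j (1 : ℝ))).neg
  have h2 : HasDerivAt (fun s : ℝ => frobInner (S + L + s • Matrix.single i j (1 : ℝ)) C)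
      (frobInner (Matrix.single i j (1 : ℝ)) C) 0 := by
    simp only [frobInner, transpose_add, transpose_smul, add_mul, smul_mul_assoc, trace_add,
      trace_smul, smul_eq_mul]
    simpa using ((hasDerivAt_id' (0 : ℝ)).mul_const
      ((Matrix.single i j (1 : ℝ))ᵀ * C).trace).const_add (frobInner (S + L) C)
  have h3 := (h1.add h2).deriv
  have hs : ((S + L)⁻¹).IsHermitian := h.inv.isHermitian
  have hij : (S + L)⁻¹ j i = (S + L)⁻¹ i j := by simpa using hs.apply i j
  simp only [matGrad, loss, Matrix.of_apply, ← add_assoc]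
  refine h3.trans ?_
  simp [frobInner, Matrix.trace_mul_comm _ (Matrix.single _ _ _), Matrix.trace_single_mul, hij]
  ring

lemma inv_sub_inv_eq (hA : IsUnit A.det) (hB : IsUnit B.det) :
    A⁻¹ - B⁻¹ = A⁻¹ * (B - A) * B⁻¹ := by
  rw [mul_sub, sub_mul, Matrix.mul_assoc, Matrix.mul_nonsing_inv _ hB,
    Matrix.nonsing_inv_mul _ hA, Matrix.mul_one, Matrix.one_mul]

lemma isHermitian_of_smul_one_le (h : a • 1 ≤ A) : A.IsHermitian := by
  have := (le_iff.mp h).isHermitian.add (isHermitian_one.smul (IsSelfAdjoint.all a))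
  simpa using this

/-- The remainder of the first-order expansion of the loss. It is `f 1 - f 0` for
`f s = s tr (Θ⁻¹ D) - log det (Θ + s D)` with `Θ = S + L₁` and `D = L₂ - L₁`, and
`f' s = s tr (D Θ⁻¹ D (Θ + s D)⁻¹)` is between `s ‖D‖² / b²` and `s ‖D‖² / a²`. -/
lemma loss_remainder_bounds (ha : 0 < a) (hb : 0 < b) {L₁ L₂ : Matrix (Fin p) (Fin p) ℝ}
    (h1 : a • 1 ≤ S + L₁) (h1' : S + L₁ ≤ b • 1) (h2 : a • 1 ≤ S + L₂) (h2' : S + L₂ ≤ b • 1) :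
    1 / b ^ 2 / 2 * frobNorm (L₂ - L₁) ^ 2 ≤
        loss S C L₂ - loss S C L₁ - frobInner (matGrad (loss S C) L₁) (L₂ - L₁) ∧
      loss S C L₂ - loss S C L₁ - frobInner (matGrad (loss S C) L₁) (L₂ - L₁) ≤
        1 / a ^ 2 / 2 * frobNorm (L₂ - L₁) ^ 2 := by
  set D := L₂ - L₁ with hD
  set Θ := S + L₁ with hΘ
  have hDh : D.IsHermitian := by
    have := (isHermitian_of_smul_one_le h2).sub (isHermitian_of_smul_one_le h1)
    simpa [hD, hΘ] using this
  have hpd : Θ.PosDef := posDef_of_le ha h1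
  have hline (s : ℝ) : Θ + s • D = (1 - s) • Θ + s • (S + L₂) := by
    rw [hD, hΘ]; module
  have hlow {s : ℝ} (h0 : 0 ≤ s) (hs : s ≤ 1) : a • 1 ≤ Θ + s • D := by
    have := add_nonneg (((le_iff.mp h1).smul (sub_nonneg.mpr hs)).nonneg)
      (((le_iff.mp h2).smul h0).nonneg)
    rw [← sub_nonneg, hline]
    convert this using 1
    module
  have hup {s : ℝ} (h0 : 0 ≤ s) (hs : s ≤ 1) : Θ + s • D ≤ b • 1 := by
    have := add_nonneg (((le_iff.mp h1').smul (sub_nonneg.mpr hs)).nonneg)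
      (((le_iff.mp h2').smul h0).nonneg)
    rw [← sub_nonneg, hline]
    convert this using 1
    module
  let f : ℝ → ℝ := fun s => (Θ⁻¹ * D).trace * s - Real.log (Θ + s • D).det
  have hf {s : ℝ} (h0 : 0 ≤ s) (hs : s ≤ 1) :
      HasDerivAt f (s * (D * Θ⁻¹ * D * (Θ + s • D)⁻¹).trace) s := by
    have hsp := posDef_of_le ha (hlow h0 hs)
    have := ((hasDerivAt_id' s).const_mul (Θ⁻¹ * D).trace).sub
      (hasDerivAt_log_det_line s D hsp)
    refine this.congr_deriv ?_
    rw [mul_one, ← trace_sub, ← sub_mul,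
      inv_sub_inv_eq ((Matrix.isUnit_iff_isUnit_det _).mp hpd.isUnit)
        ((Matrix.isUnit_iff_isUnit_det _).mp hsp.isUnit), add_sub_cancel_left,
      Matrix.trace_mul_comm]
    simp [Matrix.mul_assoc]
  have hfd {s : ℝ} (h0 : 0 ≤ s) (hs : s ≤ 1) :
      s * (1 / b ^ 2 * frobNorm D ^ 2) ≤ s * (D * Θ⁻¹ * D * (Θ + s • D)⁻¹).trace ∧
      s * (D * Θ⁻¹ * D * (Θ + s • D)⁻¹).trace ≤ s * (1 / a ^ 2 * frobNorm D ^ 2) := by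
    have hsp := posDef_of_le ha (hlow h0 hs)
    have hl := le_trace_sandwich hDh (inv_nonneg.mpr hb.le) (inv_nonneg.mpr hb.le)
      (le_inv_of_le hpd hb h1') (le_inv_of_le hsp hb (hup h0 hs))
    have hu := trace_sandwich_le hDh (inv_nonneg.mpr ha.le) (inv_le_of_le ha h1)
      hsp.inv.posSemidef.nonneg (inv_le_of_le ha (hlow h0 hs))
    rw [← sq, inv_pow, ← one_div (_ ^ 2 : ℝ)] at hl hu
    exact ⟨mul_le_mul_of_nonneg_left hl h0, mul_le_mul_of_nonneg_left hu h0⟩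
  have hrem : loss S C L₂ - loss S C L₁ - frobInner (matGrad (loss S C) L₁) D = f 1 - f 0 := by
    have e1 : Θ + (1 : ℝ) • D = S + L₂ := by rw [hD, hΘ]; module
    have e2 : D = (S + L₂) - Θ := by rw [hD, hΘ]; abel
    have hi : (Θ⁻¹).IsHermitian := hpd.inv.isHermitian
    have e3 : frobInner (C - Θ⁻¹) D = frobInner (S + L₂) C - frobInner Θ C - (Θ⁻¹ * D).trace := by
      rw [← frobInner_eq_trace hi, ← inner_entries, ← inner_entries, ← inner_entries,
        ← inner_entries, map_sub, inner_sub_left, real_inner_comm, e2, map_sub, inner_sub_left]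
    rw [matGrad_loss hpd, e3]
    simp only [f, e1, loss, zero_smul, add_zero, mul_one, mul_zero, ← hΘ]
    ring
  have hquad (c s : ℝ) : HasDerivAt (fun s : ℝ => c / 2 * s ^ 2) (s * c) s := by
    refine ((hasDerivAt_pow 2 s).const_mul (c / 2)).congr_deriv ?_
    push_cast; ring
  rw [hrem]
  constructor
  · have hm : MonotoneOn (fun s => f s - (1 / b ^ 2 * frobNorm D ^ 2) / 2 * s ^ 2)
        (Set.Icc 0 1) := by
      refine monotoneOn_of_hasDerivWithinAt_nonneg (convex_Icc 0 1)
        (f' := fun s => s * (D * Θ⁻¹ * D * (Θ + s • D)⁻¹).trace -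
          s * (1 / b ^ 2 * frobNorm D ^ 2)) (fun s hs => ?_) (fun s hs => ?_) (fun s hs => ?_)
      · exact ((hf hs.1 hs.2).sub (hquad _ s)).continuousAt.continuousWithinAt
      · have hs := interior_subset hs
        exact ((hf hs.1 hs.2).sub (hquad _ s)).hasDerivWithinAt
      · have hs := interior_subset hs
        exact sub_nonneg.mpr (hfd hs.1 hs.2).1
    have := hm (Set.left_mem_Icc.mpr zero_le_one) (Set.right_mem_Icc.mpr zero_le_one) zero_le_one
    simp only at this
    linarith
  · have hm : MonotoneOn (fun s => (1 / a ^ 2 * frobNorm D ^ 2) / 2 * s ^ 2 - f s)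
        (Set.Icc 0 1) := by
      refine monotoneOn_of_hasDerivWithinAt_nonneg (convex_Icc 0 1)
        (f' := fun s => s * (1 / a ^ 2 * frobNorm D ^ 2) -
          s * (D * Θ⁻¹ * D * (Θ + s • D)⁻¹).trace)
        (fun s hs => ?_) (fun s hs => ?_) (fun s hs => ?_)
      · exact ((hquad _ s).sub (hf hs.1 hs.2)).continuousAt.continuousWithinAt
      · have hs := interior_subset hs
        exact ((hquad _ s).sub (hf hs.1 hs.2)).hasDerivWithinAt
      · have hs := interior_subset hs
        exact sub_nonneg.mpr (hfd hs.1 hs.2).2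
    have := hm (Set.left_mem_Icc.mpr zero_le_one) (Set.right_mem_Icc.mpr zero_le_one) zero_le_one
    simp only at this
    linarith

end

section

variable {p : ℕ} {A B D S C L : Matrix (Fin p) (Fin p) ℝ} {a b : ℝ}

/-! ### One projected gradient step -/

lemma rank_sub_le_add (A B : Matrix (Fin p) (Fin p) ℝ) : (A - B).rank ≤ A.rank + B.rank := by
  have h : (A - B).mulVecLin.range ≤ A.mulVecLin.range ⊔ B.mulVecLin.range := by
    rintro _ ⟨x, rfl⟩
    rw [mulVecLin_apply, sub_mulVec]
    exact Submodule.sub_mem _ (Submodule.mem_sup_left ⟨x, rfl⟩) (Submodule.mem_sup_right ⟨x, rfl⟩)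
  exact (Submodule.finrank_mono h).trans (Submodule.finrank_add_le_finrank_add_finrank _ _)

/-- A nearest point `B` of a set containing `Z` satisfies `‖B - Z‖² ≤ 2⟨A - Z, B - Z⟩`. -/
lemma frobNorm_sub_sq_le {Z : Matrix (Fin p) (Fin p) ℝ} (h : frobNorm (A - B) ≤ frobNorm (A - Z)) :
    frobNorm (B - Z) ^ 2 ≤ 2 * frobInner (A - Z) (B - Z) := by
  have h1 : A - B = (A - Z) - (B - Z) := by abel
  rw [← norm_entries, ← norm_entries, h1, map_sub] at h
  rw [← norm_entries, ← inner_entries]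
  have h2 := norm_sub_sq_real (entries (A - Z)) (entries (B - Z))
  have h3 := pow_le_pow_left₀ (norm_nonneg _) h 2
  linarith

/-- The exact gradient step contracts: for `A`, `B` with spectrum in `[a, b]`, gradient steps of
`-log det` with step size `η` shrink their distance by `√(1 + M²η² - 2mη)`, where `m = 1/b²` and
`M = 1/a²`. -/
lemma frobNorm_sub_smul_inv_le (ha : 0 < a) (hb : 0 < b) {η : ℝ} (hη : 0 ≤ η)
    (hA : a • 1 ≤ A) (hA' : A ≤ b • 1) (hB : a • 1 ≤ B) (hB' : B ≤ b • 1) :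
    2 * frobNorm ((B - A) - η • (A⁻¹ - B⁻¹)) ≤
      rho (1 / b ^ 2) (1 / a ^ 2) η * frobNorm (B - A) := by
  have hAp := posDef_of_le ha hA
  have hBp := posDef_of_le ha hB
  have hD : (B - A).IsHermitian := hBp.isHermitian.sub hAp.isHermitian
  have hH : A⁻¹ - B⁻¹ = A⁻¹ * (B - A) * B⁻¹ :=
    inv_sub_inv_eq ((Matrix.isUnit_iff_isUnit_det _).mp hAp.isUnit)
      ((Matrix.isUnit_iff_isUnit_det _).mp hBp.isUnit)
  have hA0 := hAp.inv.posSemidef.nonneg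
  have hB0 := hBp.inv.posSemidef.nonneg
  have h1 : 1 / b ^ 2 * frobNorm (B - A) ^ 2 ≤ frobInner (B - A) (A⁻¹ - B⁻¹) := by
    have := le_trace_sandwich hD (inv_nonneg.mpr hb.le) (inv_nonneg.mpr hb.le)
      (le_inv_of_le hAp hb hA') (le_inv_of_le hBp hb hB')
    rw [← sq, inv_pow, ← one_div (_ ^ 2 : ℝ)] at this
    rw [frobInner_eq_trace hD, hH]
    simpa only [Matrix.mul_assoc] using this
  have h2 : frobNorm (A⁻¹ - B⁻¹) ^ 2 ≤ (1 / a ^ 2) ^ 2 * frobNorm (B - A) ^ 2 := by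
    have := trace_sandwich_le hD (by positivity)
      (mul_self_le (by positivity) hA0 (inv_le_of_le ha hA))
      (Commute.mul_nonneg hB0 hB0 rfl) (mul_self_le (by positivity) hB0 (inv_le_of_le ha hB))
    have e : a⁻¹ * a⁻¹ * (a⁻¹ * a⁻¹) = (1 / a ^ 2) ^ 2 := by field_simp
    rw [e] at this
    refine le_of_eq_of_le ?_ this
    rw [frobNorm_sq, frobInner_eq_trace (hAp.inv.isHermitian.sub hBp.inv.isHermitian)]
    have hT : (A⁻¹ - B⁻¹) = B⁻¹ * (B - A) * A⁻¹ := by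
      rw [← (hAp.inv.isHermitian.sub hBp.inv.isHermitian).eq, hH]
      simp only [conjTranspose_mul, hD.eq, hAp.inv.isHermitian.eq, hBp.inv.isHermitian.eq,
        Matrix.mul_assoc]
    conv_lhs => rw [hH]; arg 1; arg 1; rw [← hH, hT]
    rw [Matrix.mul_assoc, Matrix.mul_assoc, Matrix.trace_mul_comm]
    simp only [Matrix.mul_assoc]
  have h3 : frobNorm ((B - A) - η • (A⁻¹ - B⁻¹)) ^ 2 ≤
      (1 + (1 / a ^ 2) ^ 2 * η ^ 2 - 2 * (1 / b ^ 2) * η) * frobNorm (B - A) ^ 2 := by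
    have e : frobNorm ((B - A) - η • (A⁻¹ - B⁻¹)) ^ 2 = frobNorm (B - A) ^ 2
        - 2 * η * frobInner (B - A) (A⁻¹ - B⁻¹) + η ^ 2 * frobNorm (A⁻¹ - B⁻¹) ^ 2 := by
      rw [← norm_entries, ← norm_entries, ← norm_entries, ← inner_entries, map_sub, map_smul,
        norm_sub_sq_real, inner_smul_right, norm_smul, mul_pow, Real.norm_eq_abs, sq_abs]
      ring
    rw [e]
    have := mul_le_mul_of_nonneg_left h1 hη
    have := mul_le_mul_of_nonneg_left h2 (sq_nonneg η)
    linarith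
  rw [rho, mul_assoc]
  refine mul_le_mul_of_nonneg_left ?_ zero_le_two
  rw [← Real.sqrt_sq (frobNorm_nonneg (B - A)), ← Real.sqrt_mul' _ (sq_nonneg _)]
  exact Real.le_sqrt_of_sq_le h3

/-- One step of EP-LVM. The nearest-point inequality pairs `D = L' - Lstar`, of rank at most `2 r`,
with the sum of a contracted error and the sampling error `C - (S + Lstar)⁻¹`. -/
lemma frobNorm_step_le (ha : 0 < a) (hb : 0 < b) {η : ℝ} (hη : 0 ≤ η) {r : ℕ}
    {Lstar L' : Matrix (Fin p) (Fin p) ℝ} (hLs : Lstar.PosSemidef) (hr : Lstar.rank ≤ r)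
    (h1 : a • 1 ≤ S + Lstar) (h1' : S + Lstar ≤ b • 1) (h2 : a • 1 ≤ S + L) (h2' : S + L ≤ b • 1)
    (hproj : IsPsdLowRankProj r (L - η • matGrad (loss S C) L) L') :
    frobNorm (L' - Lstar) ≤ rho (1 / b ^ 2) (1 / a ^ 2) η * frobNorm (L - Lstar) +
      2 * (η * (Real.sqrt (2 * r) * specNorm (C - (S + Lstar)⁻¹))) := by
  have hV := frobNorm_sub_smul_inv_le ha hb hη h1 h1' h2 h2'
  rw [add_sub_add_left_eq_sub] at hV
  set D := L' - Lstar with hD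
  have hDh : D.IsHermitian := hproj.1.isHermitian.sub hLs.isHermitian
  have hDr : D.rank ≤ 2 * r := by
    have := rank_sub_le_add L' Lstar
    have := hproj.2.1
    rw [hD]
    omega
  have hs := frobNorm_sub_sq_le (hproj.2.2 Lstar hLs hr)
  have hsplit : L - η • matGrad (loss S C) L - Lstar =
      (L - Lstar - η • ((S + Lstar)⁻¹ - (S + L)⁻¹)) - η • (C - (S + Lstar)⁻¹) := by
    rw [matGrad_loss (posDef_of_le ha h2)]; module
  rw [hsplit, ← inner_entries, map_sub, map_smul, inner_sub_left, real_inner_smul_left,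
    inner_entries, real_inner_comm, inner_entries, ← hD] at hs
  have hN := neg_le_of_abs_le (abs_frobInner_le_of_rank_le hDh hDr (C - (S + Lstar)⁻¹))
  have hcs := frobInner_le (L - Lstar - η • ((S + Lstar)⁻¹ - (S + L)⁻¹)) D
  push_cast at hN
  have hN' := mul_le_mul_of_nonneg_left hN hη
  have hDn := frobNorm_nonneg D
  have hVn := mul_le_mul_of_nonneg_right hV hDn
  rcases hDn.eq_or_lt with h0 | h0
  · rw [← h0]
    have := frobNorm_nonneg (L - Lstar)
    have := specNorm_nonneg (C - (S + Lstar)⁻¹)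
    unfold rho
    positivity
  · refine le_of_mul_le_mul_right ?_ h0
    nlinarith

/-- All iterates stay in the region when the sampling error is small: the Frobenius distance to
`Lstar` starts at `‖Lstar‖_F ≤ √r ‖Lstar‖₂` and each step multiplies it by `ρ` and adds at most
`(1 - ρ) δ`, so it never exceeds `√r ‖Lstar‖₂ + δ`. -/
lemma iterates_mem_region {r : ℕ} {Lstar : Matrix (Fin p) (Fin p) ℝ} {δ η : ℝ}
    (hLs : Lstar.PosSemidef) (hr : Lstar.rank ≤ r) (hδ : 0 < δ) (ha : 0 < a) (hb : 0 < b)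
    (hη : 0 ≤ η) (hρ : rho (1 / b ^ 2) (1 / a ^ 2) η < 1)
    (hreg : ∀ L ∈ region r Lstar δ, a • 1 ≤ S + L ∧ S + L ≤ b • 1)
    (herr : 2 * (η * (Real.sqrt (2 * r) * specNorm (C - (S + Lstar)⁻¹))) ≤
      (1 - rho (1 / b ^ 2) (1 / a ^ 2) η) * δ)
    {L : ℕ → Matrix (Fin p) (Fin p) ℝ} (hL : IsEPLVM S C r η L) (t : ℕ) :
    L t ∈ region r Lstar δ := by
  have hLs0 := specNorm_nonneg Lstar
  have hLsm : Lstar ∈ region r Lstar δ := by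
    refine ⟨hLs, ?_⟩
    have := mul_nonneg (Real.sqrt_nonneg r) hLs0
    linarith
  have key {L' : Matrix (Fin p) (Fin p) ℝ} (h : L'.PosSemidef)
      (h' : frobNorm (L' - Lstar) ≤ Real.sqrt r * specNorm Lstar + δ) :
      L' ∈ region r Lstar δ := by
    refine ⟨h, ?_⟩
    have := specNorm_le_add L' Lstar
    have := specNorm_le_frobNorm (L' - Lstar)
    linarith
  suffices h : (L t).PosSemidef ∧ frobNorm (L t - Lstar) ≤ Real.sqrt r * specNorm Lstar + δ from
    key h.1 h.2
  induction t with
  | zero =>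
    rw [hL.1]
    refine ⟨PosSemidef.zero, ?_⟩
    have := frobNorm_le_sqrt_rank_mul_specNorm hLs.isHermitian hr
    rw [← norm_entries, zero_sub, map_neg, norm_neg, norm_entries]
    linarith
  | succ t ih =>
    refine ⟨(hL.2 t).1, ?_⟩
    have hs := hreg _ hLsm
    have ht := hreg _ (key ih.1 ih.2)
    have hstep := frobNorm_step_le ha hb hη hLs hr hs.1 hs.2 ht.1 ht.2 (hL.2 t)
    have hρ0 : 0 ≤ rho (1 / b ^ 2) (1 / a ^ 2) η := by unfold rho; positivity
    have h1 := mul_le_mul_of_nonneg_left ih.2 hρ0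
    have h2 := mul_nonneg (sub_nonneg.mpr hρ.le) (mul_nonneg (Real.sqrt_nonneg r) hLs0)
    nlinarith

end

section

/-! ### Tails of centred squares of Gaussian variables -/

/-- Equivalently, `-log (1 - y) ≤ y + y²`. -/
lemma one_le_one_sub_mul_exp {y : ℝ} (h2 : y ≤ 1 / 2) :
    1 ≤ (1 - y) * Real.exp (y + y ^ 2) := by
  rcases le_total 0 y with h0 | h0
  · have h := Real.quadratic_le_exp_of_nonneg (x := y + y ^ 2) (by positivity)
    refine le_trans ?_ (mul_le_mul_of_nonneg_left h (by linarith))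
    have h3 : 0 ≤ y ^ 2 * ((1 - 2 * y) * (1 + y + y ^ 2) ) := by
      have : 0 ≤ 1 - 2 * y := by linarith
      positivity
    nlinarith [pow_nonneg h0 3, pow_nonneg h0 4, pow_nonneg h0 5]
  · have h := Real.add_one_le_exp (y + y ^ 2)
    refine le_trans ?_ (mul_le_mul_of_nonneg_left h (by linarith))
    nlinarith [mul_nonneg (neg_nonneg.mpr h0) (sq_nonneg y)]

/-- The moment generating function of a centred Gaussian square is `e^{-tv} / √(1 - 2tv)`, hence at
most `e^{2 (tv)²}` for `|tv| ≤ 1/4`. Positivity rules out that the integral is a junk value. -/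
lemma integral_exp_sq_sub_gaussianReal {v : ℝ≥0} {t : ℝ} (ht : |t * v| ≤ 1 / 4) :
    0 < ∫ x, Real.exp (t * (x ^ 2 - v)) ∂(gaussianReal 0 v) ∧
      ∫ x, Real.exp (t * (x ^ 2 - v)) ∂(gaussianReal 0 v) ≤ Real.exp (2 * (t * v) ^ 2) := by
  rcases eq_or_ne v 0 with rfl | hv
  · simp
  have hv0 : (0 : ℝ) < v := by exact_mod_cast pos_iff_ne_zero.mpr hv
  have ht' := abs_le.mp ht
  have hc : 0 < 1 - 2 * (t * v) := by linarith [ht'.2]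
  have hval : ∫ x, Real.exp (t * (x ^ 2 - v)) ∂(gaussianReal 0 v) =
      Real.exp (-(t * v)) * (Real.sqrt (1 - 2 * (t * v)))⁻¹ := by
    rw [integral_gaussianReal_eq_integral_smul hv]
    have e (x : ℝ) : gaussianPDFReal 0 v x • Real.exp (t * (x ^ 2 - v)) =
        (Real.exp (-(t * v)) * (Real.sqrt (2 * Real.pi * v))⁻¹) *
          Real.exp (-((1 - 2 * (t * v)) / (2 * v)) * x ^ 2) := by
      rw [gaussianPDFReal, smul_eq_mul, sub_zero]
      have : Real.exp (-x ^ 2 / (2 * v)) * Real.exp (t * (x ^ 2 - v)) =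
          Real.exp (-(t * v)) * Real.exp (-((1 - 2 * (t * v)) / (2 * v)) * x ^ 2) := by
        rw [← Real.exp_add, ← Real.exp_add]
        congr 1
        field_simp
        ring
      linear_combination (Real.sqrt (2 * Real.pi * v))⁻¹ * this
    simp_rw [e]
    rw [integral_const_mul, integral_gaussian, mul_assoc]
    congr 1
    rw [← Real.sqrt_inv, ← Real.sqrt_inv, ← Real.sqrt_mul (by positivity)]
    congr 1
    have := Real.pi_pos
    field_simp
  rw [hval]
  refine ⟨by positivity, ?_⟩
  rw [← div_eq_mul_inv, div_le_iff₀ (Real.sqrt_pos.mpr hc)]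
  have h := one_le_one_sub_mul_exp (y := 2 * (t * v)) (by linarith)
  refine abs_le_of_sq_le_sq' ?_ (by positivity) |>.2
  rw [mul_pow, Real.sq_sqrt hc.le, ← Real.exp_nat_mul, ← Real.exp_nat_mul]
  have h2 := mul_le_mul_of_nonneg_left h (Real.exp_pos (-(2 * (t * v)))).le
  rw [mul_one, mul_left_comm (Real.exp _), ← Real.exp_add, neg_add_cancel_left] at h2
  rw [mul_comm (Real.exp _)]
  convert h2 using 3 <;> push_cast <;> ring

variable {Ω : Type*} [MeasurableSpace Ω] {P : Measure Ω} [IsProbabilityMeasure P] {n : ℕ}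

lemma measure_sum_sq_sub_ge {Z : Fin n → Ω → ℝ} {v : ℝ≥0} (hind : iIndepFun Z P)
    (hZ : ∀ i, HasLaw (Z i) (gaussianReal 0 v) P) {t : ℝ} (ht : |t * v| ≤ 1 / 4) (τ : ℝ) :
    P.real {ω | τ ≤ t * ∑ i, (Z i ω ^ 2 - v)} ≤ Real.exp (-τ + n * (2 * (t * v) ^ 2)) := by
  let W : Fin n → Ω → ℝ := fun i ω => t * (Z i ω ^ 2 - v)
  have hg : Measurable fun x : ℝ => t * (x ^ 2 - v) := by fun_prop
  have hW : iIndepFun W P := hind.comp (fun _ x => t * (x ^ 2 - v)) fun _ => hg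
  have hWm (i) : AEMeasurable (W i) P := hg.comp_aemeasurable (hZ i).aemeasurable
  have hmgf (i) : mgf (W i) P 1 = ∫ x, Real.exp (t * (x ^ 2 - v)) ∂(gaussianReal 0 v) := by
    rw [mgf, ← (hZ i).integral_comp (f := fun x => Real.exp (t * (x ^ 2 - v)))
      (by fun_prop)]
    simp [W]
  have hsum := hW.mgf_sum₀ hWm (t := 1) Finset.univ
  simp only [hmgf, Finset.prod_const, Finset.card_univ, Fintype.card_fin] at hsum
  obtain ⟨hpos, hle⟩ := integral_exp_sq_sub_gaussianReal ht
  -- a positive mgf is not the junk value, so the exponential is integrable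
  have hint : Integrable (fun ω => Real.exp (1 * (∑ i, W i) ω)) P := by
    by_contra h
    rw [mgf, integral_undef h] at hsum
    exact (pow_pos hpos n).ne hsum
  have h := measure_ge_le_exp_mul_mgf (μ := P) τ zero_le_one hint
  rw [hsum] at h
  have hset : {ω | τ ≤ t * ∑ i, (Z i ω ^ 2 - v)} = {ω | τ ≤ (∑ i, W i) ω} := by
    ext ω
    simp only [Set.mem_ofPred_eq, Finset.sum_apply, W, Finset.mul_sum]
  rw [hset]
  refine h.trans ?_
  rw [Real.exp_add, Real.exp_nat_mul, neg_one_mul]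
  gcongr

/-- Bernstein's inequality for averages of centred squares of independent Gaussian variables whose
variance `v` is at most `s`. -/
lemma measure_abs_avg_sq_sub_ge {Z : Fin n → Ω → ℝ} {v : ℝ≥0} (hind : iIndepFun Z P)
    (hZ : ∀ i, HasLaw (Z i) (gaussianReal 0 v) P) {s τ : ℝ} (hs : 0 < s) (hv : v ≤ s)
    (hτ : 0 ≤ τ) (hτs : τ ≤ s) :
    P.real {ω | n * τ ≤ |∑ i, (Z i ω ^ 2 - v)|} ≤ 2 * Real.exp (-(n * τ ^ 2 / (8 * s ^ 2))) := by
  -- this `t` minimizes the Chernoff exponent `-t n τ + 2 n t² s²`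
  set t := τ / (4 * s ^ 2) with ht
  have ht0 : 0 ≤ t := by positivity
  have hts : t * s = τ / (4 * s) := by rw [ht]; field_simp
  have htv : t * v ≤ τ / (4 * s) := hts ▸ mul_le_mul_of_nonneg_left hv ht0
  have h14 : τ / (4 * s) ≤ 1 / 4 := by
    rw [div_le_div_iff₀ (by positivity) (by norm_num)]; linarith
  have htv0 : 0 ≤ t * v := mul_nonneg ht0 v.2
  have habs : |t * v| ≤ 1 / 4 := by rw [abs_of_nonneg htv0]; linarith
  have hexp : -(t * (n * τ)) + n * (2 * (t * v) ^ 2) ≤ -(n * τ ^ 2 / (8 * s ^ 2)) := by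
    have : (t * v) ^ 2 ≤ (τ / (4 * s)) ^ 2 := pow_le_pow_left₀ htv0 htv 2
    have h2 : (n : ℝ) * (2 * (t * v) ^ 2) ≤ n * (2 * (τ / (4 * s)) ^ 2) := by gcongr
    refine (add_le_add_right h2 _).trans (le_of_eq ?_)
    rw [ht]; field_simp; ring
  have h1 := measure_sum_sq_sub_ge hind hZ habs (t * (n * τ))
  have h2 := measure_sum_sq_sub_ge hind hZ (t := -t) (by rwa [neg_mul, abs_neg]) (t * (n * τ))
  rw [neg_mul, neg_sq] at h2
  have hsub : {ω | n * τ ≤ |∑ i, (Z i ω ^ 2 - v)|} ⊆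
      {ω | t * (n * τ) ≤ t * ∑ i, (Z i ω ^ 2 - v)} ∪
      {ω | t * (n * τ) ≤ -t * ∑ i, (Z i ω ^ 2 - v)} := by
    intro ω hω
    have hω' : n * τ ≤ |∑ i, (Z i ω ^ 2 - v)| := hω
    rcases le_abs.mp hω' with h | h
    · exact Or.inl (mul_le_mul_of_nonneg_left h ht0)
    · refine Or.inr ?_
      rw [Set.mem_ofPred_eq, neg_mul, ← mul_neg]
      exact mul_le_mul_of_nonneg_left h ht0
  calc _ ≤ _ := measureReal_mono hsub
    _ ≤ _ := measureReal_union_le _ _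
    _ ≤ Real.exp (-(n * τ ^ 2 / (8 * s ^ 2))) + Real.exp (-(n * τ ^ 2 / (8 * s ^ 2))) := by
      refine add_le_add (h1.trans ?_) (h2.trans ?_) <;> exact Real.exp_le_exp.mpr hexp
    _ = _ := by ring

end

section

variable {p : ℕ}

/-! ### Nets and the spectral norm -/

/-- A `1/2`-net of the unit ball of `ℝ^p` with at most `5^p` points. -/
lemma exists_half_net (p : ℕ) : ∃ s : Finset (EuclideanSpace ℝ (Fin p)), s.card ≤ 5 ^ p ∧
    (∀ c ∈ s, ‖c‖ ≤ 1) ∧ ∀ x : EuclideanSpace ℝ (Fin p), ‖x‖ ≤ 1 → ∃ c ∈ s, ‖x - c‖ ≤ 1 / 2 := by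
  classical
  let Q : Finset (EuclideanSpace ℝ (Fin p)) → Prop := fun s =>
    (∀ c ∈ s, ‖c‖ ≤ 1) ∧ ∀ c ∈ s, ∀ d ∈ s, c ≠ d → 1 / 2 ≤ ‖c - d‖
  have hcard (s) (hs : Q s) : s.card ≤ 5 ^ p := by
    have h2 : (2 : ℝ) ≠ 0 := two_ne_zero
    have h := Besicovitch.card_le_of_separated
      (s.image fun x : EuclideanSpace ℝ (Fin p) => (2 : ℝ) • x) ?_ ?_
    · rwa [Finset.card_image_of_injective _ (smul_right_injective _ h2),
        finrank_euclideanSpace_fin] at h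
    · simp only [Finset.forall_mem_image, norm_smul, Real.norm_ofNat]
      intro c hc
      linarith [hs.1 c hc]
    · simp only [Finset.forall_mem_image]
      intro c hc d hd hcd
      rw [← smul_sub, norm_smul, Real.norm_ofNat]
      linarith [hs.2 c hc d hd fun h => hcd (h ▸ rfl)]
  -- a separated set of maximal cardinality is a net
  obtain ⟨s, hs, hmax⟩ : ∃ s, Q s ∧ ∀ s', Q s' → s'.card ≤ s.card := by
    have hne : ∃ k, ∃ s, Q s ∧ s.card = k := ⟨0, ∅, by simp [Q], rfl⟩
    have hb : ∀ k, (∃ s, Q s ∧ s.card = k) → k ≤ 5 ^ p := by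
      rintro k ⟨s, hs, rfl⟩; exact hcard s hs
    obtain ⟨k, hk⟩ := hne
    have hspec := Nat.findGreatest_spec (P := fun k => ∃ s, Q s ∧ s.card = k) (hb k hk) hk
    obtain ⟨s, hs, hsk⟩ := hspec
    exact ⟨s, hs, fun s' hs' => hsk ▸ Nat.le_findGreatest (hcard s' hs') ⟨s', hs', rfl⟩⟩
  refine ⟨s, hcard s hs, hs.1, fun x hx => ?_⟩
  by_contra! hcon
  have hxs : x ∉ s := fun h => by simpa using (hcon x h).trans' (by norm_num : (0:ℝ) < 1 / 2)
  have hQ : Q (insert x s) := by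
    refine ⟨fun c hc => ?_, fun c hc d hd hcd => ?_⟩
    · rcases Finset.mem_insert.mp hc with rfl | hc
      exacts [hx, hs.1 c hc]
    · rcases Finset.mem_insert.mp hc with rfl | hc' <;>
        rcases Finset.mem_insert.mp hd with rfl | hd'
      · exact absurd rfl hcd
      · exact (hcon d hd').le
      · rw [norm_sub_rev]; exact (hcon c hc').le
      · exact hs.2 c hc' d hd' hcd
  have := hmax _ hQ
  rw [Finset.card_insert_of_notMem hxs] at this
  omega

/-- The spectral norm of a symmetric matrix is controlled by its quadratic form at exponentially
many points of the unit ball: a net controls the bilinear form, and polarization turns its values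
into values of the quadratic form at half sums and half differences of net points. -/
lemma exists_finset_specNorm_le (p : ℕ) : ∃ U : Finset (EuclideanSpace ℝ (Fin p)),
    U.card ≤ 2 * 25 ^ p ∧ (∀ u ∈ U, ‖u‖ ≤ 1) ∧
      ∀ (A : Matrix (Fin p) (Fin p) ℝ) (τ : ℝ), A.IsHermitian → 0 ≤ τ →
        (∀ u ∈ U, |u ⬝ᵥ A *ᵥ u| ≤ τ) → specNorm A ≤ 8 * τ := by
  classical
  obtain ⟨s, hcard, hs, hnet⟩ := exists_half_net p
  refine ⟨((s ×ˢ s).image fun c => (1 / 2 : ℝ) • (c.1 + c.2)) ∪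
    ((s ×ˢ s).image fun c => (1 / 2 : ℝ) • (c.1 - c.2)), ?_, ?_, ?_⟩
  · have h : (s ×ˢ s).card ≤ 25 ^ p := by
      rw [Finset.card_product]
      calc _ ≤ 5 ^ p * 5 ^ p := Nat.mul_le_mul hcard hcard
        _ = 25 ^ p := by rw [← mul_pow]; norm_num
    calc _ ≤ _ := Finset.card_union_le _ _
      _ ≤ 25 ^ p + 25 ^ p :=
        add_le_add (Finset.card_image_le.trans h) (Finset.card_image_le.trans h)
      _ = _ := by ring
  · intro u hu
    rcases Finset.mem_union.mp hu with hu | hu <;> obtain ⟨c, hc, rfl⟩ := Finset.mem_image.mp hu <;>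
      obtain ⟨h1, h2⟩ := Finset.mem_product.mp hc <;> rw [norm_smul]
    · have := norm_add_le c.1 c.2
      norm_num
      linarith [hs _ h1, hs _ h2]
    · have := norm_sub_le c.1 c.2
      norm_num
      linarith [hs _ h1, hs _ h2]
  · intro A τ hA hτ hU
    set T := toEuclideanCLM (n := Fin p) (𝕜 := ℝ) A with hT
    have hsym (x y : EuclideanSpace ℝ (Fin p)) : inner ℝ x (T y) = inner ℝ y (T x) := by
      rw [inner_toEuclideanCLM, inner_toEuclideanCLM, dotProduct_mulVec, ← mulVec_transpose,
        ← conjTranspose_eq_transpose_of_trivial, hA.eq, dotProduct_comm]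
    simp only [← inner_toEuclideanCLM] at hU
    have hbil (c) (hc : c ∈ s) (d) (hd : d ∈ s) : |inner ℝ c (T d)| ≤ 2 * τ := by
      have h1 := hU _ (Finset.mem_union_left _ (Finset.mem_image_of_mem _
        (Finset.mk_mem_product hc hd)))
      have h2 := hU _ (Finset.mem_union_right _ (Finset.mem_image_of_mem _
        (Finset.mk_mem_product hc hd)))
      have e : inner ℝ c (T d) = inner ℝ ((1 / 2 : ℝ) • (c + d)) (T ((1 / 2 : ℝ) • (c + d))) -
          inner ℝ ((1 / 2 : ℝ) • (c - d)) (T ((1 / 2 : ℝ) • (c - d))) := by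
        simp only [map_smul, map_add, map_sub, real_inner_smul_left, real_inner_smul_right,
          inner_add_left, inner_add_right, inner_sub_left, inner_sub_right, hsym d c]
        ring
      rw [e]
      refine (abs_sub _ _).trans ?_
      linarith
    -- a half-net recovers half of a norm, first of `T d`, then of `T`
    have hTd (d) (hd : d ∈ s) : ‖T d‖ ≤ 4 * τ := by
      rcases eq_or_ne (T d) 0 with h0 | h0
      · rw [h0, norm_zero]; positivity
      have hn : 0 < ‖T d‖ := norm_pos_iff.mpr h0
      obtain ⟨c, hc, hcd⟩ := hnet (‖T d‖⁻¹ • T d) (by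
        rw [norm_smul, norm_inv, norm_norm, inv_mul_cancel₀ hn.ne'])
      have h1 : inner ℝ (‖T d‖⁻¹ • T d) (T d) = ‖T d‖ := by
        rw [real_inner_smul_left, real_inner_self_eq_norm_sq]; field_simp
      have h2 : inner ℝ (‖T d‖⁻¹ • T d - c) (T d) ≤ 1 / 2 * ‖T d‖ :=
        (real_inner_le_norm _ _).trans (mul_le_mul_of_nonneg_right hcd hn.le)
      rw [inner_sub_left, h1] at h2
      linarith [(le_abs_self _).trans (hbil c hc d hd)]
    have hle : specNorm A ≤ 4 * τ + 1 / 2 * specNorm A := by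
      refine ContinuousLinearMap.opNorm_le_of_unit_norm (𝕜 := ℝ)
        (by have := specNorm_nonneg A; positivity) fun x hx => ?_
      obtain ⟨d, hd, hxd⟩ := hnet x hx.le
      have e : T x = T d + T (x - d) := by rw [← map_add]; congr 1; abel
      calc _ = ‖T d + T (x - d)‖ := by rw [← e]
        _ ≤ ‖T d‖ + ‖T (x - d)‖ := norm_add_le _ _
        _ ≤ 4 * τ + specNorm A * (1 / 2) := by
          refine add_le_add (hTd d hd) ((T.le_opNorm _).trans ?_)
          exact mul_le_mul_of_nonneg_left hxd (norm_nonneg _)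
        _ = _ := by ring
    linarith

/-! ### Concentration of the sample covariance -/

variable {Ω : Type*} [MeasurableSpace Ω] {P : Measure Ω} {n : ℕ}

lemma dotProduct_sampleCov_mulVec (x : Fin n → EuclideanSpace ℝ (Fin p))
    (u : EuclideanSpace ℝ (Fin p)) :
    u ⬝ᵥ sampleCov x *ᵥ u = 1 / n * ∑ i, inner ℝ u (x i) ^ 2 := by
  have h : sampleCov x = (1 / n : ℝ) • ∑ i, vecMulVec (x i : Fin p → ℝ) (x i) := by
    ext a b
    simp [sampleCov, Matrix.sum_apply, vecMulVec_apply]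
  rw [h, smul_mulVec, dotProduct_smul, Matrix.sum_mulVec, dotProduct_sum, smul_eq_mul]
  congr 1
  refine Finset.sum_congr rfl fun i _ => ?_
  have e : inner ℝ u (x i) = (u : Fin p → ℝ) ⬝ᵥ x i := by
    rw [PiLp.inner_apply]; simp [dotProduct, mul_comm]
  rw [e, vecMulVec_mulVec, dotProduct_comm (x i : Fin p → ℝ)]
  simp [sq]

lemma isHermitian_sampleCov (x : Fin n → EuclideanSpace ℝ (Fin p)) :
    (sampleCov x).IsHermitian := by
  ext a b
  simp [sampleCov, mul_comm]

lemma hasLaw_inner {K : Matrix (Fin p) (Fin p) ℝ} (hK : K.PosSemidef)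
    {Y : Ω → EuclideanSpace ℝ (Fin p)}
    (hY : HasLaw Y (multivariateGaussian 0 K) P) (u : EuclideanSpace ℝ (Fin p)) :
    HasLaw (fun ω => inner ℝ u (Y ω)) (gaussianReal 0 (u ⬝ᵥ K *ᵥ u).toNNReal) P := by
  have h : HasLaw (innerSL ℝ u) (gaussianReal 0 (u ⬝ᵥ K *ᵥ u).toNNReal)
      (multivariateGaussian 0 K) := by
    refine ⟨by fun_prop, ?_⟩
    rw [IsGaussian.map_eq_gaussianReal, ← covarianceBilin_multivariateGaussian (μ := 0) hK,
      covarianceBilin_self IsGaussian.memLp_two_id,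
      (innerSL ℝ u).integral_comp_id_comm IsGaussian.integrable_id,
      integral_id_multivariateGaussian, map_zero]
    rfl
  exact h.comp hY

variable [IsProbabilityMeasure P]

/-- With probability at least `1 - 2 e^{-p}`, the sample covariance of `n ≥ 40 p` Gaussian vectors
is within `8 s √(40 p / n)` of the covariance `K`, where `s` is the spectral norm of `K`. -/
lemma exists_event_specNorm_sampleCov_sub_le {K : Matrix (Fin p) (Fin p) ℝ} (hK : K.PosSemidef)
    (hp : 0 < p) (hs : 0 < specNorm K) (hn : 40 * p ≤ n)
    {X : Fin n → Ω → EuclideanSpace ℝ (Fin p)} (hind : iIndepFun X P)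
    (hX : ∀ i, HasLaw (X i) (multivariateGaussian 0 K) P) :
    ∃ E : Set Ω, MeasurableSet E ∧ 1 - 2 * Real.exp (-(p : ℝ)) ≤ P.real E ∧
      ∀ ω ∈ E, specNorm (sampleCov (fun i => X i ω) - K) ≤
        8 * (specNorm K * Real.sqrt (40 * p / n)) := by
  obtain ⟨U, hUcard, hU1, hU⟩ := exists_finset_specNorm_le p
  set s := specNorm K
  set τ := s * Real.sqrt (40 * p / n) with hτ
  have hp' : (1 : ℝ) ≤ p := by exact_mod_cast hp
  have hn' : (40 * p : ℝ) ≤ n := by exact_mod_cast hn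
  have hn0 : (0 : ℝ) < n := by linarith
  have hτ0 : 0 ≤ τ := by positivity
  have hτs : τ ≤ s := by
    refine mul_le_of_le_one_right hs.le ?_
    exact Real.sqrt_le_one.mpr ((div_le_one hn0).mpr hn')
  have hexp : n * τ ^ 2 / (8 * s ^ 2) = 5 * p := by
    rw [hτ, mul_pow, Real.sq_sqrt (by positivity)]
    field_simp
    norm_num
  let v : EuclideanSpace ℝ (Fin p) → ℝ≥0 := fun u => (u ⬝ᵥ K *ᵥ u).toNNReal
  have hvc (u : EuclideanSpace ℝ (Fin p)) : (v u : ℝ) = u ⬝ᵥ K *ᵥ u :=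
    Real.coe_toNNReal _ (by simpa using hK.dotProduct_mulVec_nonneg (u : Fin p → ℝ))
  let bad : EuclideanSpace ℝ (Fin p) → Set Ω := fun u =>
    {ω | n * τ ≤ |∑ i, (inner ℝ u (X i ω) ^ 2 - (v u : ℝ))|}
  have hbad (u) (hu : u ∈ U) : P.real (bad u) ≤ 2 * Real.exp (-(5 * p)) := by
    have hv : (v u : ℝ) ≤ s := by
      rw [hvc]
      refine (le_abs_self _).trans ((abs_dotProduct_mulVec_le K u u).trans ?_)
      exact mul_le_of_le_one_right hs.le
        (mul_le_one₀ (hU1 u hu) (norm_nonneg _) (hU1 u hu))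
    have h := measure_abs_avg_sq_sub_ge (Z := fun i ω => inner ℝ u (X i ω)) (v := v u)
      (hind.comp (fun _ x => inner ℝ u x) fun _ => by fun_prop)
      (fun i => hasLaw_inner hK (hX i) u) hs hv hτ0 hτs
    rwa [hexp] at h
  set B : Set Ω := ⋃ u ∈ U, bad u with hB
  have hBP : P.real B ≤ 2 * Real.exp (-(p : ℝ)) := by
    -- `e⁴ > 50` beats the at most `2 * 25 ^ p ≤ 50 ^ p` points, leaving `e^{-p}` of `e^{-5p}`
    have h50 : (50 : ℝ) ≤ Real.exp 4 := by
      have := Real.exp_one_gt_d9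
      have h4 : Real.exp 4 = Real.exp 1 ^ 4 := by rw [← Real.exp_nat_mul]; norm_num
      rw [h4]
      calc (50 : ℝ) ≤ 2.7 ^ 4 := by norm_num
        _ ≤ _ := pow_le_pow_left₀ (by norm_num) (by linarith) 4
    have hc : (U.card : ℝ) ≤ Real.exp 4 ^ p := by
      have h1 : (U.card : ℝ) ≤ 2 * 25 ^ p := by exact_mod_cast hUcard
      have h2 : (2 : ℝ) ≤ 2 ^ p := le_self_pow₀ one_le_two hp.ne'
      calc (U.card : ℝ) ≤ 2 ^ p * 25 ^ p := h1.trans (by gcongr)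
        _ = 50 ^ p := by rw [← mul_pow]; norm_num
        _ ≤ _ := by gcongr
    calc P.real B ≤ ∑ u ∈ U, P.real (bad u) := measureReal_biUnion_finset_le _ _
      _ ≤ ∑ u ∈ U, 2 * Real.exp (-(5 * p)) := Finset.sum_le_sum hbad
      _ = U.card * (2 * Real.exp (-(5 * p))) := by rw [Finset.sum_const, nsmul_eq_mul]
      _ ≤ Real.exp 4 ^ p * (2 * Real.exp (-(5 * p))) := by gcongr
      _ = 2 * Real.exp (-(p : ℝ)) := by
        rw [← Real.exp_nat_mul, mul_left_comm, ← Real.exp_add]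
        congr 2
        ring
  -- the `X i` are only a.e. measurable, so `B` itself need not be measurable
  refine ⟨(toMeasurable P B)ᶜ, (measurableSet_toMeasurable P B).compl, ?_, fun ω hω => ?_⟩
  · rw [probReal_compl_eq_one_sub (measurableSet_toMeasurable P B), measureReal_def,
      measure_toMeasurable, ← measureReal_def]
    linarith
  · have hωB : ω ∉ B := fun h => hω (subset_toMeasurable P B h)
    refine hU _ _ ((isHermitian_sampleCov _).sub hK.isHermitian) hτ0 fun u hu => ?_
    have h1 : ω ∉ bad u := fun h => hωB (Set.mem_biUnion hu h)
    have h2 : |∑ i, (inner ℝ u (X i ω) ^ 2 - (v u : ℝ))| < n * τ := not_le.mp h1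
    have e : u ⬝ᵥ (sampleCov (fun i => X i ω) - K) *ᵥ u =
        1 / n * ∑ i, (inner ℝ u (X i ω) ^ 2 - (v u : ℝ)) := by
      rw [sub_mulVec, dotProduct_sub, dotProduct_sampleCov_mulVec, Finset.sum_sub_distrib,
        Finset.sum_const, Finset.card_univ, Fintype.card_fin, nsmul_eq_mul, hvc]
      field_simp
    rw [e, abs_mul, abs_of_pos (by positivity), one_div, inv_mul_le_iff₀ hn0]
    exact h2.le

end

section

/-! ### The constants and the sample size -/

/-- `ρ < 1` says `M²η² - 2mη + 3/4 < 0`. As `m ≤ M`, also `(Mη)² - 2Mη + 3/4 < 0`, which has the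
roots `1/2` and `3/2`. -/
lemma step_size_bounds {m M η : ℝ} (hm : 0 < m) (hmM : m ≤ M) (hρ : rho m M η < 1) :
    0.5 / M ≤ η ∧ η ≤ 1.5 / m := by
  have hM : 0 < M := hm.trans_le hmM
  have h0 : 1 + M ^ 2 * η ^ 2 - 2 * m * η < (1 / 2) ^ 2 := by
    rw [rho] at hρ
    exact (Real.sqrt_lt' (by norm_num)).mp (by linarith)
  have hη : 0 < η := by
    by_contra! h
    nlinarith [mul_nonneg hm.le (neg_nonneg.mpr h), mul_nonneg (sq_nonneg M) (sq_nonneg η)]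
  have h1 : (M * η - 1 / 2) * (M * η - 3 / 2) < 0 := by
    have : m * η ≤ M * η := by gcongr
    nlinarith
  have h2 : 1 / 2 < M * η := by
    by_contra! h
    nlinarith
  have h3 : M * η < 3 / 2 := by
    by_contra! h
    nlinarith
  constructor
  · rw [div_le_iff₀ hM]; linarith
  · rw [le_div_iff₀ hm]
    have : m * η ≤ M * η := by gcongr
    linarith

lemma region_spectral_bounds {p r : ℕ} {S Lstar L : Matrix (Fin p) (Fin p) ℝ} {δ : ℝ}
    (hS : S.IsHermitian) (hL : L ∈ region r Lstar δ) :
    eigMin S • 1 ≤ S + L ∧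
      S + L ≤ (eigMax S + (1 + Real.sqrt r) * specNorm Lstar + δ) • 1 := by
  constructor
  · exact (eigMin_smul_one_le hS).trans (le_add_of_nonneg_right hL.1.nonneg)
  · rw [add_assoc, add_smul]
    exact add_le_add (le_eigMax_smul_one hS) (le_smul_one_of_specNorm_le hL.1.isHermitian hL.2)

lemma mem_region_self {p r : ℕ} {Lstar : Matrix (Fin p) (Fin p) ℝ} {δ : ℝ}
    (hL : Lstar.PosSemidef) (hδ : 0 < δ) : Lstar ∈ region r Lstar δ := by
  refine ⟨hL, ?_⟩
  have := mul_nonneg (Real.sqrt_nonneg r) (specNorm_nonneg Lstar)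
  linarith

lemma inv_le_specNorm_inv {p : ℕ} (hp : 0 < p) {A : Matrix (Fin p) (Fin p) ℝ} {b : ℝ}
    (hA : A.PosDef) (hb : 0 < b) (h : A ≤ b • 1) : b⁻¹ ≤ specNorm A⁻¹ := by
  have h1 := le_iff.mp (le_inv_of_le hA hb h)
  let i : Fin p := ⟨0, hp⟩
  let e : EuclideanSpace ℝ (Fin p) := EuclideanSpace.single i 1
  have h2 := h1.diag_nonneg (i := i)
  have h3 := abs_dotProduct_mulVec_le A⁻¹ e e
  have h4 : (e : Fin p → ℝ) ⬝ᵥ A⁻¹ *ᵥ e = A⁻¹ i i := by simp [e]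
  have h5 : ‖e‖ = 1 := by simp [e]
  rw [h4, h5] at h3
  have h6 : b⁻¹ ≤ A⁻¹ i i := by simpa using h2
  linarith [le_abs_self (A⁻¹ i i)]

/-- `r = 0`: the only matrix of rank at most `0` is zero, so all iterates vanish. -/
lemma iterates_mem_region_zero {p : ℕ} {S C Lstar : Matrix (Fin p) (Fin p) ℝ} {δ η : ℝ}
    (hδ : 0 < δ) {L : ℕ → Matrix (Fin p) (Fin p) ℝ} (hL : IsEPLVM S C 0 η L) (t : ℕ) :
    L t ∈ region 0 Lstar δ := by
  have h0 : L t = 0 := by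
    cases t with
    | zero => exact hL.1
    | succ t =>
      have h := Submodule.finrank_eq_zero.mp (Nat.le_zero.mp (hL.2 t).2.1)
      exact Matrix.toLin'.injective ((LinearMap.range_eq_bot.mp h).trans (map_zero _).symm)
  rw [h0]
  refine ⟨PosSemidef.zero, ?_⟩
  have h1 : specNorm (0 : Matrix (Fin p) (Fin p) ℝ) = 0 := by simp [specNorm]
  have := mul_nonneg (add_nonneg zero_le_one (Real.sqrt_nonneg (0 : ℕ))) (specNorm_nonneg Lstar)
  rw [h1]
  linarith

/-- The scale on which the sample size is measured is at least `1`: `s η ≥ δ`, because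
`s ≥ 1/b`, `η ≥ a²/2`, and both `b - a` and `δ` are small compared with `a`. -/
lemma delta_le_mul {a b s η δ κ : ℝ} (ha : 0 < a) (hb : 0 < b) (hs : b⁻¹ ≤ s) (hη : a ^ 2 / 2 ≤ η)
    (hκ : κ ≤ 1.08) (hbκ : b ≤ κ * a) (hab : a + δ ≤ b) : δ ≤ s * η := by
  have hb' : b ≤ 1.08 * a := hbκ.trans (by gcongr)
  have hs0 : 0 ≤ s := (inv_pos.mpr hb).le.trans hs
  have h1 : b⁻¹ * (a ^ 2 / 2) ≤ s * η := by gcongr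
  refine le_trans ?_ h1
  rw [inv_mul_eq_div, le_div_iff₀ hb]
  have hδ' : δ ≤ 0.08 * a := by linarith
  calc δ * b ≤ (0.08 * a) * (1.08 * a) := by gcongr
    _ ≤ a ^ 2 / 2 := by nlinarith [sq_nonneg a]

/-- The assumed sample size is at least `20480 p`, as the concentration inequality needs. -/
lemma le_sample_size {s η q δ r p : ℝ} (hs : 0 < s) (hδ : 0 < δ) (hq : 0 < q) (hq1 : q ≤ 1)
    (h : δ ≤ s * η) (hr : 1 ≤ r) (hp : 0 ≤ p) :
    20480 * p ≤ 20480 * s ^ 2 * (1 / δ ^ 2 * (η / q) ^ 2 * (r * p)) := by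
  have hη : 0 < η := by
    by_contra! hη
    nlinarith
  have h1 : 1 ≤ s * η / (δ * q) := by
    rw [one_le_div₀ (by positivity)]
    exact (mul_le_of_le_one_right hδ.le hq1).trans h
  have h2 : 1 ≤ (s * η / (δ * q)) ^ 2 * r :=
    one_le_mul_of_one_le_of_one_le (one_le_pow₀ h1) hr
  have h3 := mul_le_mul_of_nonneg_left h2 (show 0 ≤ 20480 * p by positivity)
  refine le_of_le_of_eq (le_of_eq_of_le (mul_one _).symm h3) ?_
  field_simp

/-- The constant `20480 = 80 * 16²` is what makes the sampling error at most `(1 - ρ) δ`, written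
`q δ` here; `80 r p / n` is the product of `2 r` and `40 p / n` under the roots. -/
lemma sampling_error_le {s η q δ n r p : ℝ} (hs : 0 < s) (hη : 0 < η) (hq : 0 < q) (hδ : 0 < δ)
    (hr : 0 ≤ r) (hn0 : 0 < n)
    (hn : 20480 * s ^ 2 * (1 / δ ^ 2 * (η / q) ^ 2 * (r * p)) ≤ n) :
    2 * (η * (Real.sqrt (2 * r) * (8 * (s * Real.sqrt (40 * p / n))))) ≤ q * δ := by
  have e : Real.sqrt (2 * r) * Real.sqrt (40 * p / n) = Real.sqrt (80 * (r * p) / n) := by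
    rw [← Real.sqrt_mul (by positivity)]
    congr 1
    ring
  have h : Real.sqrt (80 * (r * p) / n) ≤ q * δ / (16 * (η * s)) := by
    rw [Real.sqrt_le_left (by positivity), div_pow, div_le_div_iff₀ hn0 (by positivity)]
    have h2 := mul_le_mul_of_nonneg_left hn (show 0 ≤ (q * δ) ^ 2 by positivity)
    refine le_of_eq_of_le ?_ h2
    field_simp
    ring
  rw [le_div_iff₀ (by positivity)] at h
  calc _ = Real.sqrt (2 * r) * Real.sqrt (40 * p / n) * (16 * (η * s)) := by ring
    _ ≤ _ := by rw [e]; exact h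

end

end LVM

theorem theorem2 :
    ∃ c : ℝ, 0 < c ∧
      ∀ (p n r : ℕ) (S Lstar : Matrix (Fin p) (Fin p) ℝ) (δ η m M ρ : ℝ)
        (Ω : Type*) [MeasurableSpace Ω] (P : Measure Ω) [IsProbabilityMeasure P]
        (X : Fin n → Ω → EuclideanSpace ℝ (Fin p)),
        -- the model
        S.PosDef → Lstar.PosSemidef → Lstar.rank ≤ r →
        iIndepFun X P →
        (∀ i, HasLaw (X i) (multivariateGaussian 0 (S + Lstar)⁻¹) P) →
        -- the spectral assumption
        0 < δ →
        LVM.eigMin S ≤ LVM.eigMax S →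
        LVM.eigMax S ≤ Real.sqrt (2 / Real.sqrt 3) * LVM.eigMin S
          - (1 + Real.sqrt r) * LVM.specNorm Lstar - δ →
        -- the constants
        m = LVM.mConst r S Lstar δ → M = LVM.MConst S → ρ = LVM.rho m M η → ρ < 1 →
        -- the number of samples
        c * LVM.specNorm (S + Lstar)⁻¹ ^ 2 * ((1 / δ ^ 2) * (η / (1 - ρ)) ^ 2 * (r * p)) ≤ n →
        -- the constants satisfy the assumptions of linear convergence
        0 < m ∧ 1 ≤ M / m ∧ M / m ≤ 2 / Real.sqrt 3 ∧ 0.5 / M ≤ η ∧ η ≤ 1.5 / m ∧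
        -- with high probability RSC/RSS holds on a region that contains the true matrix
        -- and every iterate
        ∃ E : Set Ω, MeasurableSet E ∧ 1 - 2 * Real.exp (-(p : ℝ)) ≤ P.real E ∧
          ∀ ω ∈ E,
            LVM.RSCRSSOn (LVM.loss S (LVM.sampleCov fun i => X i ω)) (3 * r) m M
              (LVM.region r Lstar δ) ∧
            Lstar ∈ LVM.region r Lstar δ ∧
            ∀ L : ℕ → Matrix (Fin p) (Fin p) ℝ,
              LVM.IsEPLVM S (LVM.sampleCov fun i => X i ω) r η L →
                ∀ t, L t ∈ LVM.region r Lstar δ := by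
  refine ⟨20480, by norm_num, ?_⟩
  intro p n r S Lstar δ η m M ρ Ω _ P _ X hS hL hr hind hX hδ hS1 hS2 hm hM hρ hρ1 hn
  subst hm hM hρ
  set a := LVM.eigMin S with ha_def
  set b := LVM.eigMax S + (1 + Real.sqrt r) * LVM.specNorm Lstar + δ with hb_def
  have hmb : LVM.mConst r S Lstar δ = 1 / b ^ 2 := rfl
  have hMa : LVM.MConst S = 1 / a ^ 2 := rfl
  rw [hmb, hMa] at hρ1 hn ⊢
  set κ := Real.sqrt (2 / Real.sqrt 3) with hκ_def
  have h3 : 0 < Real.sqrt 3 := by positivity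
  have h3sq : Real.sqrt 3 ^ 2 = 3 := Real.sq_sqrt (by norm_num)
  have hκsq : κ ^ 2 = 2 / Real.sqrt 3 := Real.sq_sqrt (by positivity)
  have hκ1 : 1 < κ := by
    rw [hκ_def, Real.lt_sqrt zero_le_one, lt_div_iff₀ h3]
    nlinarith
  have hκ2 : κ ≤ 1.08 := by
    rw [hκ_def, Real.sqrt_le_left (by norm_num), div_le_iff₀ h3]
    nlinarith
  have hT : 0 ≤ (1 + Real.sqrt r) * LVM.specNorm Lstar :=
    mul_nonneg (by positivity) (LVM.specNorm_nonneg _)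
  have hbκ : b ≤ κ * a := by linarith
  have hab : a + δ ≤ b := by linarith
  have ha : 0 < a := by
    by_contra! h
    nlinarith
  have hb : 0 < b := by linarith
  have hp : 0 < p := by
    rcases Nat.eq_zero_or_pos p with rfl | hp
    · exfalso
      -- the spectrum is empty, and its infimum is the junk value `0`
      have : a = 0 := by
        rw [ha_def, LVM.eigMin, spectrum.of_subsingleton, Real.sInf_empty]
      exact ha.ne' this
    · exact hp
  have hm0 : 0 < 1 / b ^ 2 := by positivity
  have hmM : 1 / b ^ 2 ≤ 1 / a ^ 2 :=
    one_div_le_one_div_of_le (by positivity) (pow_le_pow_left₀ ha.le (by linarith) 2)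
  obtain ⟨hη1, hη2⟩ := LVM.step_size_bounds hm0 hmM hρ1
  refine ⟨hm0, (one_le_div₀ hm0).mpr hmM, ?_, hη1, hη2, ?_⟩
  · rw [← hκsq, div_div_div_cancel_left' _ _ one_ne_zero, ← div_pow]
    exact pow_le_pow_left₀ (by positivity) ((div_le_iff₀ ha).mpr hbκ) 2
  have hreg (L) (h : L ∈ LVM.region r Lstar δ) := LVM.region_spectral_bounds hS.isHermitian h
  have hLreg := LVM.mem_region_self (r := r) hL hδ
  have hRSC (C : Matrix (Fin p) (Fin p) ℝ) :
      LVM.RSCRSSOn (LVM.loss S C) (3 * r) (1 / b ^ 2) (1 / a ^ 2) (LVM.region r Lstar δ) :=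
    fun L₁ h₁ L₂ h₂ _ _ => LVM.loss_remainder_bounds ha hb (hreg _ h₁).1 (hreg _ h₁).2
      (hreg _ h₂).1 (hreg _ h₂).2
  rcases Nat.eq_zero_or_pos r with rfl | hr0
  · refine ⟨Set.univ, MeasurableSet.univ, ?_, fun ω _ => ⟨hRSC _, hLreg, fun L hLit t =>
      LVM.iterates_mem_region_zero hδ hLit t⟩⟩
    rw [probReal_univ]
    linarith [Real.exp_pos (-(p : ℝ))]
  have hΘ := LVM.posDef_of_le ha (hreg _ hLreg).1
  have hs := LVM.inv_le_specNorm_inv hp hΘ hb (hreg _ hLreg).2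
  set s := LVM.specNorm (S + Lstar)⁻¹
  have hs0 : 0 < s := (inv_pos.mpr hb).trans_le hs
  have hη3 : a ^ 2 / 2 ≤ η := by
    refine le_of_eq_of_le ?_ hη1
    field_simp
    norm_num
  have hη0 : 0 < η := lt_of_lt_of_le (by positivity) hη3
  set q := 1 - LVM.rho (1 / b ^ 2) (1 / a ^ 2) η with hq_def
  have hq : 0 < q := by linarith
  have hq1 : q ≤ 1 := by
    have : 0 ≤ LVM.rho (1 / b ^ 2) (1 / a ^ 2) η := by unfold LVM.rho; positivity
    linarith
  have hr1 : (1 : ℝ) ≤ r := by exact_mod_cast hr0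
  have hp1 : (1 : ℝ) ≤ p := by exact_mod_cast hp
  have hn40 : (20480 * p : ℝ) ≤ n := (LVM.le_sample_size hs0 hδ hq hq1
    (LVM.delta_le_mul ha hb hs hη3 hκ2 hbκ hab) hr1 (by positivity)).trans hn
  have hn0 : (0 : ℝ) < n := by linarith
  have hpn : 40 * p ≤ n := by
    have : (40 * p : ℝ) ≤ n := by linarith
    exact_mod_cast this
  obtain ⟨E, hE, hPE, hEω⟩ := LVM.exists_event_specNorm_sampleCov_sub_le hΘ.inv.posSemidef hp hs0
    hpn hind hX
  refine ⟨E, hE, hPE, fun ω hω => ⟨hRSC _, hLreg, fun L hLit t => ?_⟩⟩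
  refine LVM.iterates_mem_region hL hr hδ ha hb hη0.le hρ1 hreg ?_ hLit t
  refine le_trans ?_ (LVM.sampling_error_le hs0 hη0 hq hδ (by positivity) hn0 hn)
  gcongr
  exact hEω ω hω
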